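/- **Corollary 2.** A coloring $c$ of a graph $G$ is *nonrepetitive* if there is no path $u_1,\dots,u_{2l}$ ($l\ge 1$) in $G$ with $c(u_i)=c(u_{l+i})$ for all $1\le i\le l$. A *$k$-tree* is a graph obtained from the complete graph on $k+1$ vertices by repeatedly adding a new vertex joined to a clique of size $k$; a *partial $k$-tree* is a subgraph of a $k$-tree. An *online partial $k$-tree* is a finite or infinite sequence of graphs $G_0,G_1,\dots,G_n$ ($n\le\infty$) such that $G_0$ is a single vertex $v_0$ and, for each $t\ge 1$ with $t\le n$, the graph $G_{t-1}$ is a partial $k$-tree and $G_t$ arises from $G_{t-1}$ by adding a new vertex $v_t$ joined to the vertices of a (possibly empty) clique of $G_{t-1}$ of size at most $k$ and deleting an arbitrary set $C_t\subseteq E(G_{t-1})$ of old edges. For every integer $k\ge 0$, $4^k$ colors suffice to color online nonrepetitively any partial $k$-tree: there is a strategy that assigns to each new vertex $v_t$, at the moment of its arrival and knowing only $G_0,\dots,G_t$, one of $4^k$ colors, never to be changed, such that for every online partial $k$-tree $G_0,\dots,G_n$ ($n\le\infty$) and every $t\ge 0$ with $t\le n$, the resulting coloring of $G_t$ is nonrepetitive.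 -/

import Mathlib

/-- A sequence is a repetition if it is a nonempty block followed by the same block, i.e. it is
`x_1 ... x_{2l}` with `l ≥ 1` and `x_i = x_{l+i}` for `1 ≤ i ≤ l`. -/
def IsRepetition {α : Type*} (x : List α) : Prop :=
  ∃ w : List α, w ≠ [] ∧ x = w ++ w

/-- A coloring `c` of `G` is nonrepetitive if the sequence of colors along a path of `G`
is never a repetition. -/
def IsNonrepetitive {V α : Type*} (G : SimpleGraph V) (c : V → α) : Prop :=
  ∀ (u v : V) (p : G.Walk u v), p.IsPath → ¬ IsRepetition (p.support.map c)

/-- Add a new (last) vertex to `G`, joined exactly to the vertices in `D`. -/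
def addVertex {n : ℕ} (G : SimpleGraph (Fin n)) (D : Finset (Fin n)) :
    SimpleGraph (Fin (n + 1)) :=
  G.map Fin.castSuccEmb ⊔
    SimpleGraph.fromEdgeSet ((fun u : Fin n => s(u.castSucc, Fin.last n)) '' (D : Set (Fin n)))

/-- `k`-trees, with the vertices numbered in a construction order: start with the complete graph
on `k + 1` vertices, and repeatedly join a new vertex to a clique of size `k`. -/
inductive IsKTree (k : ℕ) : {n : ℕ} → SimpleGraph (Fin n) → Prop
  | complete : IsKTree k (⊤ : SimpleGraph (Fin (k + 1)))
  | attach {n : ℕ} (T : SimpleGraph (Fin n)) (D : Finset (Fin n)) :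
      IsKTree k T → T.IsNClique k D → IsKTree k (addVertex T D)

/-- A partial `k`-tree is a graph isomorphic to a (not necessarily induced or spanning) subgraph
of a `k`-tree. -/
def IsPartialKTree (k : ℕ) {V : Type*} (G : SimpleGraph V) : Prop :=
  ∃ (n : ℕ) (T : SimpleGraph (Fin n)), IsKTree k T ∧ G.IsContained T

/-- One step of an online process: a new vertex arrives, joined to the set `D` of old vertices,
and the set `C` of old edges is deleted. -/
def onlineStep {n : ℕ} (G : SimpleGraph (Fin n)) (D : Finset (Fin n))
    (C : Set (Sym2 (Fin n))) : SimpleGraph (Fin (n + 1)) :=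
  addVertex (G.deleteEdges C) D

/-- A restriction on the moves of an online process: `R G D C` says that, if `G` is the current
graph, then the new vertex may be joined to `D` while the edges in `C` are deleted. -/
abbrev OnlineRestriction : Type :=
  ∀ {n : ℕ}, SimpleGraph (Fin n) → Finset (Fin n) → Set (Sym2 (Fin n)) → Prop

/-- `G 0, G 1, ...` up to `G n` (`n = ⊤` is allowed) is an online process obeying `R`, starting
from a single vertex. The vertices of `G t` are `v_0, ..., v_t`; vertex `v_i` is the element `i`
of `Fin (t + 1)`. The graphs `G t` with `t > n` are irrelevant. -/
def IsOnlineProcess (R : OnlineRestriction) (n : ℕ∞)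
    (G : (t : ℕ) → SimpleGraph (Fin (t + 1))) : Prop :=
  ∀ t : ℕ, (t : ℕ∞) < n → ∃ (D : Finset (Fin (t + 1))) (C : Set (Sym2 (Fin (t + 1)))),
    C ⊆ (G t).edgeSet ∧ R (G t) D C ∧ G (t + 1) = onlineStep (G t) D C

/-- An online coloring strategy: the color of `v_t` is chosen when `v_t` arrives, knowing only
the graphs `G 0, ..., G t` seen so far. -/
abbrev OnlineStrategy (α : Type*) : Type _ :=
  (t : ℕ) → ((s : Fin (t + 1)) → SimpleGraph (Fin (s.val + 1))) → α

/-- The color that the strategy `σ` gives to `v_t` when the process is `G`. -/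
def OnlineStrategy.color {α : Type*} (σ : OnlineStrategy α)
    (G : (t : ℕ) → SimpleGraph (Fin (t + 1))) (t : ℕ) : α :=
  σ t (fun s => G s.val)

/-- The graphs generated according to `R` can be colored nonrepetitively online with colors
in `α`: some strategy ensures, for every process obeying `R`, that the coloring of each graph
occurring in the process is nonrepetitive. -/
def OnlineNonrepetitivelyColorable (R : OnlineRestriction) (α : Type*) : Prop :=
  ∃ σ : OnlineStrategy α, ∀ (n : ℕ∞) (G : (t : ℕ) → SimpleGraph (Fin (t + 1))),
    IsOnlineProcess R n G →
      ∀ t : ℕ, (t : ℕ∞) ≤ n → IsNonrepetitive (G t) (fun i : Fin (t + 1) => σ.color G i.val)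

/-- The restriction for online partial `k`-trees: the current graph `G` is a partial `k`-tree, and
the new vertex is joined to a clique of `G` of size at most `k`; any set `C` of edges of `G`
may be deleted. -/
def onlinePartialKTree (k : ℕ) : OnlineRestriction :=
  fun G D _ => IsPartialKTree k G ∧ G.IsClique (D : Set _) ∧ D.card ≤ k

/-! The online coloring follows the Kündgen–Pelsmajer coloring of graphs of bounded tree-width.

Never deleting an edge only adds paths, so all edges that ever appear may be kept
(`AttachmentOrder.ofHistory`, `IsOnlineProcess.adj_last`). In the resulting graph each vertex is
attached on its arrival to a clique of at most `k` earlier vertices. Give it a level: one more than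
the least level in this clique, or `0` if the clique is empty. Levels of adjacent vertices differ by
at most one, and a vertex is attached to at most `k - 1` vertices of its own level, so by induction
on `k` the graph of the edges inside levels is colored with `4 ^ (k - 1)` colors. This color is
combined with one of four colors for the level (`levelColor`), taken from a square-free sequence in
which any three consecutive terms are distinct; such a sequence is obtained from the Thue–Morse
sequence. All this is known when the vertex arrives (`AttachmentOrder.color_congr`).

Suppose that a path is colored repetitively. Its levels form a lazy walk on `ℕ` colored repetitively
by `levelColor`, which forces corresponding vertices of the two halves to have the same level
(`lazy_walk_halves_eq`). The vertices of lowest level `m` on the path thus carry a repetition of the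
colors inside their level. Between two consecutive ones, the path runs in a component of the levels
above `m`; the neighbors of such a component on level `m` form a clique, since they are among the
vertices to which its first vertex was attached (`AttachmentOrder.IsChordal.adj_of_mem_shadow`). So
the vertices of level `m` form a path inside their level, which contradicts the induction
hypothesis (`AttachmentOrder.IsChordal.color_nonrepetitive`). -/

/-! ### A square-free sequence on four letters without `aba` -/

/-- The Thue–Morse sequence: the parity of the number of binary digits `1` of `n`. -/
def thueMorse (n : ℕ) : Bool :=
  if h : n = 0 then false else xor (decide (n % 2 = 1)) (thueMorse (n / 2))
termination_by n
decreasing_by omega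

lemma thueMorse_two_mul (n : ℕ) : thueMorse (2 * n) = thueMorse n := by
  rcases Nat.eq_zero_or_pos n with rfl | hn
  · rfl
  · rw [thueMorse, dif_neg (by omega)]
    have h1 : (2 * n) % 2 = 0 := by omega
    have h2 : (2 * n) / 2 = n := by omega
    simp [h2]

lemma thueMorse_two_mul_add_one (n : ℕ) : thueMorse (2 * n + 1) = !thueMorse n := by
  rw [thueMorse, dif_neg (by omega)]
  have h1 : (2 * n + 1) % 2 = 1 := by omega
  have h2 : (2 * n + 1) / 2 = n := by omega
  simp [h1, h2]

lemma thueMorse_ne_succ_of_even {n : ℕ} (hn : n % 2 = 0) :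
    thueMorse n ≠ thueMorse (n + 1) := by
  obtain ⟨j, rfl⟩ : ∃ j, n = 2 * j := ⟨n / 2, by omega⟩
  rw [thueMorse_two_mul, thueMorse_two_mul_add_one]
  simp

/-- The Thue–Morse sequence is overlap-free. An overlap of even period restricts to one of half
the period on the positions of one parity. Since the values at `2 j` and `2 j + 1` differ, an
overlap of odd period alternates throughout, and then its period cannot be odd. -/
lemma thueMorse_overlapFree (p : ℕ) (hp : 0 < p) (m : ℕ) :
    ¬ ∀ i ≤ p, thueMorse (m + i) = thueMorse (m + i + p) := by
  induction p using Nat.strong_induction_on generalizing m with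
  | _ p ih =>
  intro h
  rcases Nat.mod_two_eq_zero_or_one p with hp2 | hp2
  · obtain ⟨q, rfl⟩ : ∃ q, p = 2 * q := ⟨p / 2, by omega⟩
    refine ih q (by omega) (by omega) (m / 2) fun i hi => ?_
    have := h (2 * i) (by omega)
    rcases Nat.mod_two_eq_zero_or_one m with hm | hm
    · rwa [show m + 2 * i + 2 * q = 2 * (m / 2 + i + q) by omega,
        show m + 2 * i = 2 * (m / 2 + i) by omega, thueMorse_two_mul, thueMorse_two_mul] at this
    · rwa [show m + 2 * i + 2 * q = 2 * (m / 2 + i + q) + 1 by omega,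
        show m + 2 * i = 2 * (m / 2 + i) + 1 by omega, thueMorse_two_mul_add_one,
        thueMorse_two_mul_add_one, Bool.not_inj_iff] at this
  · have alt : ∀ i < p, thueMorse (m + i) ≠ thueMorse (m + i + 1) := by
      intro i hi
      rcases Nat.mod_two_eq_zero_or_one (m + i) with he | ho
      · exact thueMorse_ne_succ_of_even he
      · have h1 := h i hi.le
        have h2 := h (i + 1) hi
        rw [h1, show m + i + 1 = m + (i + 1) by omega, h2,
          show m + (i + 1) + p = m + i + p + 1 by omega]
        exact thueMorse_ne_succ_of_even (by omega)
    have key : ∀ i ≤ p, thueMorse (m + i) = xor (decide (i % 2 = 1)) (thueMorse m) := by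
      intro i
      induction i with
      | zero => simp
      | succ i ihi =>
        intro hi
        have h1 := ihi (by omega)
        have h2 := alt i hi
        rw [h1, show m + i + 1 = m + (i + 1) by omega] at h2
        rcases Nat.mod_two_eq_zero_or_one i with he | ho
        · have : (i + 1) % 2 = 1 := by omega
          simp only [this, he] at h2 ⊢
          revert h2; cases thueMorse m <;> cases thueMorse (m + (i + 1)) <;> simp
        · have : (i + 1) % 2 = 0 := by omega
          simp only [this, ho] at h2 ⊢
          revert h2; cases thueMorse m <;> cases thueMorse (m + (i + 1)) <;> simp
    have h0 := h 0 (by omega)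
    have h1 := key p le_rfl
    rw [show m + 0 + p = m + p by omega, h1] at h0
    revert h0; simp [hp2]

/-- The ternary Thue sequence: the differences of consecutive terms of the Thue–Morse sequence,
encoded by the letters `0`, `1`, `2`. -/
def thueTernary (n : ℕ) : Fin 4 :=
  if thueMorse n = thueMorse (n + 1) then 0 else if thueMorse n then 1 else 2

lemma thueTernary_ne_three (n : ℕ) : thueTernary n ≠ 3 := by
  unfold thueTernary; split_ifs <;> decide

/-- A square of period `p` in the sequence of differences makes the difference of terms at
distance `p` constant. A nonzero constant is impossible since the terms are `0` or `1`, and the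
constant `0` gives an overlap. -/
lemma thueTernary_squareFree (p : ℕ) (hp : 0 < p) (m : ℕ) :
    ¬ ∀ i < p, thueTernary (m + i) = thueTernary (m + i + p) := by
  intro h
  have step : ∀ a b a' b' : Bool,
      (if a = b then (0 : Fin 4) else if a then 1 else 2) =
        (if a' = b' then (0 : Fin 4) else if a' then 1 else 2) →
      ((a = a' → b = b') ∧ (a ≠ a' → b = a ∧ b' = a')) := by decide
  have hs : ∀ i < p, _ := fun i hi => step _ _ _ _ (h i hi)
  by_cases h0 : thueMorse m = thueMorse (m + p)
  · refine thueMorse_overlapFree p hp m fun i => ?_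
    induction i with
    | zero => intro _; simpa using h0
    | succ i ih =>
      intro hi
      have := (hs i hi).1 (ih (by omega))
      rwa [show m + i + p + 1 = m + (i + 1) + p by omega] at this
  · have : ∀ i ≤ p, thueMorse (m + i) = thueMorse m := by
      have : ∀ i ≤ p, thueMorse (m + i) = thueMorse m ∧
          thueMorse (m + i + p) = thueMorse (m + p) := by
        intro i
        induction i with
        | zero => intro _; simp
        | succ i ih =>
          intro hi
          obtain ⟨h1, h2⟩ := ih (by omega)
          have := (hs i hi).2 (by rw [h1, h2]; exact h0)
          rw [show m + i + p + 1 = m + (i + 1) + p by omega, h1, h2] at this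
          exact this
      exact fun i hi => (this i hi).1
    exact h0 (this p le_rfl).symm

/-- The ternary Thue sequence with the letter `3` inserted after every second term. -/
def levelColor (n : ℕ) : Fin 4 :=
  if n % 3 = 2 then 3 else thueTernary (2 * (n / 3) + n % 3)

lemma levelColor_eq_three_iff {n : ℕ} : levelColor n = 3 ↔ n % 3 = 2 := by
  unfold levelColor
  split_ifs with h
  · simp [h]
  · simp [h, thueTernary_ne_three]

lemma thueTernary_ne_succ (n : ℕ) : thueTernary n ≠ thueTernary (n + 1) := fun h =>
  thueTernary_squareFree 1 one_pos n fun i hi => by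
    obtain rfl : i = 0 := by omega
    simpa using h

lemma levelColor_ne_succ (n : ℕ) : levelColor n ≠ levelColor (n + 1) := by
  intro h
  have h2 := @levelColor_eq_three_iff n
  rw [h, levelColor_eq_three_iff] at h2
  have h0 : n % 3 = 0 := by omega
  unfold levelColor at h
  rw [if_neg (by omega), if_neg (by omega), show (n + 1) / 3 = n / 3 by omega,
    show (n + 1) % 3 = 1 by omega, h0] at h
  exact thueTernary_ne_succ _ h

lemma levelColor_ne_add_two (n : ℕ) : levelColor n ≠ levelColor (n + 2) := by
  intro h
  have h2 := @levelColor_eq_three_iff n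
  rw [h, levelColor_eq_three_iff] at h2
  have h0 : n % 3 = 1 := by omega
  unfold levelColor at h
  rw [if_neg (by omega), if_neg (by omega), show (n + 2) / 3 = n / 3 + 1 by omega,
    show (n + 2) % 3 = 0 by omega, h0] at h
  exact thueTernary_ne_succ _ h

/-- The letter `3` forces the period of a square to be a multiple `3 q` of three, and deleting the
letters `3` then leaves a square of period `2 q` in the ternary Thue sequence. -/
lemma levelColor_squareFree (p : ℕ) (hp : 0 < p) (m : ℕ) :
    ¬ ∀ i < p, levelColor (m + i) = levelColor (m + i + p) := by
  intro h
  rcases show p = 1 ∨ p = 2 ∨ 3 ≤ p by omega with rfl | rfl | hp3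
  · exact levelColor_ne_succ m (h 0 (by omega))
  · exact levelColor_ne_add_two m (h 0 (by omega))
  have hq : p % 3 = 0 := by
    have h1 := h ((5 - m % 3) % 3) (by omega)
    have h2 : levelColor (m + (5 - m % 3) % 3) = 3 := levelColor_eq_three_iff.2 (by omega)
    rw [h2, eq_comm, levelColor_eq_three_iff] at h1
    omega
  obtain ⟨q, rfl⟩ : ∃ q, p = 3 * q := ⟨p / 3, by omega⟩
  -- The number of letters other than `3` before position `m` is `2 * (m / 3) + m % 3`.
  refine thueTernary_squareFree (2 * q) (by omega) (2 * (m / 3) + m % 3) fun i hi => ?_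
  set j := 2 * (m / 3) + m % 3 + i with hj
  have h1 := h (3 * (j / 2) + j % 2 - m) (by omega)
  rw [show m + (3 * (j / 2) + j % 2 - m) = 3 * (j / 2) + j % 2 by omega] at h1
  unfold levelColor at h1
  rw [if_neg (by omega), if_neg (by omega),
    show 2 * ((3 * (j / 2) + j % 2) / 3) + (3 * (j / 2) + j % 2) % 3 = j by omega,
    show 2 * ((3 * (j / 2) + j % 2 + 3 * q) / 3) + (3 * (j / 2) + j % 2 + 3 * q) % 3
      = j + 2 * q by omega] at h1
  exact h1

/-! ### Repetitively coloured lazy walks -/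

/-- In a sequence with steps at most `1`, a value `x` with `f 0 ≤ x < f l` is left upwards. -/
lemma exists_up_crossing {f : ℕ → ℕ} {l x : ℕ} (hf : ∀ i < l, f (i + 1) ≤ f i + 1)
    (h0 : f 0 ≤ x) (hl : x < f l) : ∃ i < l, f i = x ∧ f (i + 1) = x + 1 := by
  induction l with
  | zero => omega
  | succ l ih =>
    by_cases hx : x < f l
    · obtain ⟨i, hi, h⟩ := ih (fun i hi => hf i (by omega)) hx
      exact ⟨i, by omega, h⟩
    · have := hf l (by omega)
      exact ⟨l, by omega, by omega, by omega⟩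

lemma exists_down_crossing {f : ℕ → ℕ} {l x : ℕ} (hf : ∀ i < l, f i ≤ f (i + 1) + 1)
    (h0 : x ≤ f 0) (hl : f l < x) : ∃ i < l, f i = x ∧ f (i + 1) + 1 = x := by
  induction l with
  | zero => omega
  | succ l ih =>
    by_cases hx : f l < x
    · obtain ⟨i, hi, h⟩ := ih (fun i hi => hf i (by omega)) hx
      exact ⟨i, by omega, h⟩
    · have := hf l (by omega)
      exact ⟨l, by omega, by omega, by omega⟩

lemma eq_of_levelColor_eq {a b : ℕ} (h : levelColor a = levelColor b) (h1 : a ≤ b + 2)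
    (h2 : b ≤ a + 2) : a = b := by
  rcases show a = b ∨ b = a + 1 ∨ b = a + 2 ∨ a = b + 1 ∨ a = b + 2 by omega with
    rfl | rfl | rfl | rfl | rfl
  · rfl
  · exact absurd h (levelColor_ne_succ a)
  · exact absurd h (levelColor_ne_add_two a)
  · exact absurd h.symm (levelColor_ne_succ b)
  · exact absurd h.symm (levelColor_ne_add_two b)

/-- Two lazy walks with the same colors differ by a translation or by a reflection: as any three
consecutive levels have different colors, both walks pause and turn back at the same times. The
second conjunct in the last two alternatives remembers a level visited before the current one; it
decides whether the next step is a turn. -/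
lemma lazy_walks_congruent {f g : ℕ → ℕ} {l : ℕ}
    (hf : ∀ i, i + 1 < l → f (i + 1) ≤ f i + 1 ∧ f i ≤ f (i + 1) + 1)
    (hg : ∀ i, i + 1 < l → g (i + 1) ≤ g i + 1 ∧ g i ≤ g (i + 1) + 1)
    (hc : ∀ i < l, levelColor (f i) = levelColor (g i)) (j : ℕ) (hj : j < l) :
    (∀ i ≤ j, f i = f 0 ∧ g i = g 0) ∨
    ((∀ i ≤ j, g i + f 0 = f i + g 0) ∧ ∃ i ≤ j, f i = f j + 1 ∨ f j = f i + 1) ∨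
    ((∀ i ≤ j, g i + f i = f 0 + g 0) ∧ ∃ i ≤ j, f i = f j + 1 ∨ f j = f i + 1) := by
  induction j with
  | zero =>
    left
    intro i hi
    obtain rfl : i = 0 := by omega
    simp
  | succ j ih =>
    have hf' := hf j hj
    have hg' := hg j hj
    have hcj := hc j (by omega)
    have hcj' := hc (j + 1) hj
    have pause : f (j + 1) = f j ↔ g (j + 1) = g j := by
      constructor <;> intro h <;> refine eq_of_levelColor_eq ?_ (by omega) (by omega)
      · rw [← hcj', ← hcj, h]
      · rw [hcj', hcj, h]
    have turn : ∀ i ≤ j, (f i = f j + 1 ∨ f j = f i + 1) → (g i = g j + 1 ∨ g j = g i + 1) →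
        (f (j + 1) = f i ↔ g (j + 1) = g i) := by
      intro i hi h1 h2
      have hci := hc i (by omega)
      constructor <;> intro h <;> refine eq_of_levelColor_eq ?_ (by omega) (by omega)
      · rw [← hcj', ← hci, h]
      · rw [hcj', hci, h]
    have upTo : ∀ P : ℕ → Prop, (∀ i ≤ j, P i) → P (j + 1) → ∀ i ≤ j + 1, P i := by
      intro P h1 h2 i hi
      rcases Nat.lt_or_ge j i with h | h
      · obtain rfl : i = j + 1 := by omega
        exact h2
      · exact h1 i h
    rcases ih (by omega) with h | ⟨h, i, hi, hne⟩ | ⟨h, i, hi, hne⟩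
    · have h0 := h j le_rfl
      by_cases hp : f (j + 1) = f j
      · left
        exact upTo _ h ⟨by omega, by omega⟩
      · right
        by_cases hs : g (j + 1) + f 0 = f (j + 1) + g 0
        · left
          exact ⟨upTo _ (fun i hi => by have := h i hi; omega) hs, j, by omega, by omega⟩
        · right
          exact ⟨upTo _ (fun i hi => by have := h i hi; omega) (by omega), j, by omega, by omega⟩
    · right; left
      have h1 := h i hi
      have h2 := h j le_rfl
      have ht := turn i hi hne (by omega)
      refine ⟨upTo _ h (by omega), ?_⟩
      by_cases hp : f (j + 1) = f j
      · exact ⟨i, by omega, by omega⟩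
      · exact ⟨j, by omega, by omega⟩
    · right; right
      have h1 := h i hi
      have h2 := h j le_rfl
      have ht := turn i hi hne (by omega)
      refine ⟨upTo _ h (by omega), ?_⟩
      by_cases hp : f (j + 1) = f j
      · exact ⟨i, by omega, by omega⟩
      · exact ⟨j, by omega, by omega⟩

lemma lazy_walks_eq_of_eq {f g : ℕ → ℕ} {l : ℕ}
    (hf : ∀ i, i + 1 < l → f (i + 1) ≤ f i + 1 ∧ f i ≤ f (i + 1) + 1)
    (hg : ∀ i, i + 1 < l → g (i + 1) ≤ g i + 1 ∧ g i ≤ g (i + 1) + 1)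
    (hc : ∀ i < l, levelColor (f i) = levelColor (g i)) {j : ℕ} (hj : j < l) (h : f j = g j)
    (i : ℕ) (hi : i < l) : f i = g i := by
  rcases le_total i j with hij | hij
  · induction hij using Nat.decreasingInduction with
    | self => exact h
    | of_succ i hij ih =>
      have := ih (by omega)
      have := hf i (by omega)
      have := hg i (by omega)
      exact eq_of_levelColor_eq (hc i hi) (by omega) (by omega)
  · induction i, hij using Nat.le_induction with
    | base => exact h
    | succ i hij ih =>
      have := ih (by omega)
      have := hf i (by omega)
      have := hg i (by omega)
      exact eq_of_levelColor_eq (hc _ hi) (by omega) (by omega)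

/-- If a lazy walk on the levels is colored repetitively by `levelColor`, then its two halves are
equal. Otherwise the second half is a translate of the first, and the levels between the two
starting points carry a square, or it is a reflection, and the walk crosses the center. -/
lemma lazy_walk_halves_eq {f : ℕ → ℕ} {l : ℕ}
    (hf : ∀ i, i + 1 < 2 * l → f (i + 1) ≤ f i + 1 ∧ f i ≤ f (i + 1) + 1)
    (hc : ∀ i < l, levelColor (f i) = levelColor (f (i + l))) (i : ℕ) (hi : i < l) :
    f i = f (i + l) := by
  have hf1 : ∀ i, i + 1 < l → f (i + 1) ≤ f i + 1 ∧ f i ≤ f (i + 1) + 1 :=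
    fun i hi => hf i (by omega)
  have hg1 : ∀ i, i + 1 < l → f (i + 1 + l) ≤ f (i + l) + 1 ∧ f (i + l) ≤ f (i + 1 + l) + 1 := by
    intro i hi
    rw [show i + 1 + l = i + l + 1 by omega]
    exact hf (i + l) (by omega)
  by_contra hne
  have ne : ∀ j < l, f j ≠ f (j + l) := fun j hj h =>
    hne (lazy_walks_eq_of_eq (g := fun i => f (i + l)) hf1 hg1 hc hj h i hi)
  have ne0 := ne 0 (by omega)
  have cong := lazy_walks_congruent (g := fun i => f (i + l)) hf1 hg1 hc (l - 1) (by omega)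
  simp only [Nat.zero_add] at cong ne0
  have up : ∀ x, f 0 ≤ x → x < f l → ∃ i < l, f i = x ∧ f (i + 1) = x + 1 := fun x =>
    exists_up_crossing fun i hi => (hf i (by omega)).1
  have down : ∀ x, x ≤ f 0 → f l < x → ∃ i < l, f i = x ∧ f (i + 1) + 1 = x := fun x =>
    exists_down_crossing fun i hi => (hf i (by omega)).2
  have cases : (∀ i < l, f (i + l) + f 0 = f i + f l) ∨
      (∀ i < l, f (i + l) + f i = f 0 + f l) := by
    rcases cong with h | ⟨h, -⟩ | ⟨h, -⟩
    · left
      intro i hi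
      have := h i (by omega)
      omega
    · exact Or.inl fun i hi => h i (by omega)
    · exact Or.inr fun i hi => h i (by omega)
  rcases cases with h | h
  · rcases Nat.lt_or_gt_of_ne ne0 with hlt | hlt
    · refine levelColor_squareFree (f l - f 0) (by omega) (f 0) fun i hi => ?_
      obtain ⟨j, hj, hx, -⟩ := up (f 0 + i) (by omega) (by omega)
      have := h j hj
      rw [show f 0 + i + (f l - f 0) = f (j + l) by omega, ← hx]
      exact hc j hj
    · -- The lowest level visited by the second half is `f l + 1 - d`, where `d = f 0 - f l`.
      have hlow : f 0 - f l ≤ f l + 1 := by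
        obtain ⟨j, hj, hx, -⟩ := down (f l + 1) (by omega) (by omega)
        have := h j hj
        omega
      refine levelColor_squareFree (f 0 - f l) (by omega) (f l + 1 - (f 0 - f l)) fun i hi => ?_
      obtain ⟨j, hj, hx, -⟩ := down (f l + 1 + i) (by omega) (by omega)
      have := h j hj
      rw [show f l + 1 - (f 0 - f l) + i = f (j + l) by omega,
        show f (j + l) + (f 0 - f l) = f j by omega]
      exact (hc j hj).symm
  · -- At the center `(f 0 + f l) / 2` the two halves are at the same level or, if the center is
    -- not an integer, at consecutive ones.
    have mid : ∃ j < l, f j = (f 0 + f l) / 2 ∨ f j = (f 0 + f l + 1) / 2 := by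
      rcases Nat.lt_or_gt_of_ne ne0 with hlt | hlt
      · obtain ⟨j, hj, hx, -⟩ := up ((f 0 + f l) / 2) (by omega) (by omega)
        exact ⟨j, hj, Or.inl hx⟩
      · obtain ⟨j, hj, hx, -⟩ := down ((f 0 + f l + 1) / 2) (by omega) (by omega)
        exact ⟨j, hj, Or.inr hx⟩
    obtain ⟨j, hj, hx⟩ := mid
    have := h j hj
    exact ne j hj (eq_of_levelColor_eq (hc j hj) (by omega) (by omega))

/-! ### Attachment orders and their levels -/

/-- A graph on the vertices `0, 1, 2, …`, presented by the set `nbr v` of smaller neighbors of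
each vertex `v`, i.e. of those to which `v` is attached on its arrival. -/
structure AttachmentOrder where
  nbr : ℕ → Finset ℕ
  lt_of_mem : ∀ v, ∀ u ∈ nbr v, u < v

namespace AttachmentOrder

variable (E : AttachmentOrder)

def Adj (u v : ℕ) : Prop := u ∈ E.nbr v ∨ v ∈ E.nbr u

/-- Each vertex is attached to a clique. -/
def IsChordal : Prop := ∀ v, ∀ x ∈ E.nbr v, ∀ y ∈ E.nbr v, x < y → x ∈ E.nbr y

/-- The level of a vertex: `0` if it is attached to nothing (an infimum over the empty type is `0`
in `ℕ`), and one more than the least level of a vertex to which it is attached otherwise. In the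
chordal case this is the distance from the first vertex of its component. -/
noncomputable def level (v : ℕ) : ℕ := ⨅ u : {u // u ∈ E.nbr v}, (level u.1 + 1)
termination_by v
decreasing_by exact E.lt_of_mem v u.1 u.2

/-- The attachment order obtained by keeping the edges between vertices of the same level only. -/
noncomputable def layer : AttachmentOrder where
  nbr v := (E.nbr v).filter fun u => E.level u = E.level v
  lt_of_mem v u hu := E.lt_of_mem v u (Finset.mem_filter.1 hu).1

/-- The coloring with `4 ^ k` colors of an order in which the vertices are attached to at most `k`
vertices: the color in `Fin 4` of the level, and recursively the coloring of the layers. -/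
noncomputable def color : (k : ℕ) → AttachmentOrder → ℕ → Fin (4 ^ k)
  | 0, _, _ => 0
  | k + 1, E, v => finProdFinEquiv (color k E.layer v, levelColor (E.level v))

variable {E}

lemma level_le_succ {u v : ℕ} (h : u ∈ E.nbr v) : E.level v ≤ E.level u + 1 := by
  rw [level]
  exact ciInf_le (OrderBot.bddBelow _) (⟨u, h⟩ : {u // u ∈ E.nbr v})

lemma exists_level_eq_succ {v : ℕ} (h : (E.nbr v).Nonempty) :
    ∃ u ∈ E.nbr v, E.level v = E.level u + 1 := by
  obtain ⟨u, hu⟩ := h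
  have : Nonempty {u // u ∈ E.nbr v} := ⟨⟨u, hu⟩⟩
  obtain ⟨⟨w, hw⟩, h⟩ := ciInf_mem fun u : {u // u ∈ E.nbr v} => E.level u.1 + 1
  exact ⟨w, hw, by rw [level]; exact h.symm⟩

lemma IsChordal.level_le (hE : E.IsChordal) {u v : ℕ} (h : u ∈ E.nbr v) :
    E.level u ≤ E.level v := by
  induction v using Nat.strong_induction_on generalizing u with
  | _ v ih =>
  obtain ⟨w, hw, hv⟩ := exists_level_eq_succ ⟨u, h⟩
  rcases lt_trichotomy u w with huw | rfl | huw
  · have := ih w (E.lt_of_mem v w hw) (hE v u h w hw huw)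
    omega
  · omega
  · have := level_le_succ (hE v w hw u h huw)
    omega

lemma IsChordal.level_le_of_adj (hE : E.IsChordal) {u v : ℕ} (h : E.Adj u v) :
    E.level v ≤ E.level u + 1 ∧ E.level u ≤ E.level v + 1 := by
  rcases h with h | h
  · exact ⟨level_le_succ h, (hE.level_le h).trans (Nat.le_succ _)⟩
  · exact ⟨(hE.level_le h).trans (Nat.le_succ _), level_le_succ h⟩

lemma mem_nbr_layer {u v : ℕ} : u ∈ E.layer.nbr v ↔ u ∈ E.nbr v ∧ E.level u = E.level v :=
  Finset.mem_filter

lemma layer_adj_iff {u v : ℕ} : E.layer.Adj u v ↔ E.Adj u v ∧ E.level u = E.level v := by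
  unfold Adj
  rw [mem_nbr_layer, mem_nbr_layer]
  tauto

lemma IsChordal.layer (hE : E.IsChordal) : E.layer.IsChordal := by
  intro v x hx y hy hxy
  rw [mem_nbr_layer] at *
  exact ⟨hE v x hx.1 y hy.1 hxy, hx.2.trans hy.2.symm⟩

/-- A vertex is attached to some vertex of a lower level unless it is attached to nothing. -/
lemma card_nbr_layer_le {k : ℕ} (hk : ∀ v, (E.nbr v).card ≤ k + 1) (v : ℕ) :
    (E.layer.nbr v).card ≤ k := by
  rcases (E.nbr v).eq_empty_or_nonempty with h | h
  · have : E.layer.nbr v = ∅ := by simp [AttachmentOrder.layer, h]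
    simp [this]
  · obtain ⟨u, hu, hl⟩ := exists_level_eq_succ h
    have : E.layer.nbr v ⊂ E.nbr v := by
      refine Finset.filter_ssubset.2 ⟨u, hu, by omega⟩
    have := Finset.card_lt_card this
    have := hk v
    omega

/-! ### Shadows of the components above a level -/

open Classical in
/-- For `m < level v` in the chordal case, the set to which the first vertex of the component of `v`
in the graph induced by the levels above `m` is attached; that first vertex is reached from `v` by
moving to smaller neighbors. -/
noncomputable def shadow (E : AttachmentOrder) (m v : ℕ) : Finset ℕ :=
  if h : ∃ u ∈ E.nbr v, m < E.level u then shadow E m h.choose else E.nbr v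
termination_by v
decreasing_by exact E.lt_of_mem v _ h.choose_spec.1

lemma shadow_of_exists {m v : ℕ} (h : ∃ u ∈ E.nbr v, m < E.level u) :
    ∃ u ∈ E.nbr v, m < E.level u ∧ E.shadow m v = E.shadow m u :=
  ⟨h.choose, h.choose_spec.1, h.choose_spec.2, by rw [shadow, dif_pos h]⟩

lemma shadow_of_not_exists {m v : ℕ} (h : ¬ ∃ u ∈ E.nbr v, m < E.level u) :
    E.shadow m v = E.nbr v := by
  rw [shadow, dif_neg h]

/-- The chosen neighbor and `u` are both in the clique `nbr v`, so they are equal or adjacent, and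
induction applies to the larger one. -/
lemma IsChordal.shadow_eq (hE : E.IsChordal) {m u v : ℕ} (h : u ∈ E.nbr v) (hu : m < E.level u) :
    E.shadow m u = E.shadow m v := by
  induction v using Nat.strong_induction_on generalizing u with
  | _ v ih =>
  obtain ⟨w, hw, hmw, hs⟩ := shadow_of_exists ⟨u, h, hu⟩
  rw [hs]
  rcases lt_trichotomy u w with huw | rfl | huw
  · exact ih w (E.lt_of_mem v w hw) (hE v u h w hw huw) hu
  · rfl
  · exact (ih u (E.lt_of_mem v u h) (hE v w hw u h huw) hmw).symm

lemma IsChordal.shadow_eq_of_adj (hE : E.IsChordal) {m u v : ℕ} (h : E.Adj u v)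
    (hu : m < E.level u) (hv : m < E.level v) : E.shadow m u = E.shadow m v := by
  rcases h with h | h
  · exact hE.shadow_eq h hu
  · exact (hE.shadow_eq h hv).symm

lemma IsChordal.mem_shadow (hE : E.IsChordal) {m x v : ℕ} (h : E.Adj x v) (hx : E.level x = m)
    (hv : m < E.level v) : x ∈ E.shadow m v := by
  have aux : ∀ w, E.Adj x w → m < E.level w → x ∈ E.nbr w := by
    rintro w (hw | hw) hl
    · exact hw
    · have := hE.level_le hw
      omega
  induction v using Nat.strong_induction_on with
  | _ v ih =>
  have hxv := aux v h hv
  by_cases hex : ∃ u ∈ E.nbr v, m < E.level u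
  · obtain ⟨w, hw, hmw, hs⟩ := shadow_of_exists hex
    rw [hs]
    refine ih w (E.lt_of_mem v w hw) ?_ hmw
    rcases lt_trichotomy x w with hxw | rfl | hxw
    · exact Or.inl (hE v x hxv w hw hxw)
    · omega
    · exact Or.inr (hE v w hw x hxv hxw)
  · rwa [shadow_of_not_exists hex]

lemma IsChordal.adj_of_mem_shadow (hE : E.IsChordal) {m v x z : ℕ} (hx : x ∈ E.shadow m v)
    (hz : z ∈ E.shadow m v) (hxz : x ≠ z) : E.Adj x z := by
  induction v using Nat.strong_induction_on with
  | _ v ih =>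
  by_cases hex : ∃ u ∈ E.nbr v, m < E.level u
  · obtain ⟨w, hw, hmw, hs⟩ := shadow_of_exists hex
    rw [hs] at hx hz
    exact ih w (E.lt_of_mem v w hw) hx hz
  · rw [shadow_of_not_exists hex] at hx hz
    rcases Nat.lt_or_gt_of_ne hxz with h | h
    · exact Or.inl (hE v x hx z hz h)
    · exact Or.inr (hE v z hz x hx h)

/-! ### Paths -/

/-- The first vertex of level `m` on a path that starts above level `m` and stays at or above it
lies in the shadow of the starting point. -/
lemma IsChordal.head_filter_mem_shadow (hE : E.IsChordal) {m y z : ℕ} {s : List ℕ}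
    (hs : (y :: s).IsChain E.Adj) (hm : ∀ v ∈ s, m ≤ E.level v) (hy : m < E.level y)
    (hz : z ∈ (s.filter fun v => E.level v = m).head?) : z ∈ E.shadow m y := by
  induction s generalizing y with
  | nil => simp at hz
  | cons x s ih =>
    rw [List.isChain_cons_cons] at hs
    rcases (hm x (by simp)).eq_or_lt with hx | hx
    · rw [List.filter_cons_of_pos (by simp [hx])] at hz
      simp only [List.head?_cons, Option.mem_def, Option.some.injEq] at hz
      subst hz
      exact hE.mem_shadow (Or.symm hs.1) hx.symm hy
    · rw [List.filter_cons_of_neg (by simp [hx.ne'])] at hz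
      rw [hE.shadow_eq_of_adj hs.1 hy hx]
      exact ih hs.2 (fun v hv => hm v (by simp [hv])) hx hz

/-- The vertices of lowest level on a path form a path of the layer: between two consecutive ones,
the path runs inside a component of the levels above, so both lie in the shadow of that component,
which is a clique. -/
lemma IsChordal.isChain_filter_level (hE : E.IsChordal) {m : ℕ} {s : List ℕ}
    (hs : s.IsChain E.Adj) (hd : s.Nodup) (hm : ∀ v ∈ s, m ≤ E.level v) :
    (s.filter fun v => E.level v = m).IsChain E.layer.Adj := by
  induction s with
  | nil => simp
  | cons x s ih =>
    have hm' : ∀ v ∈ s, m ≤ E.level v := fun v hv => hm v (by simp [hv])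
    have ih := ih hs.tail hd.tail hm'
    by_cases hx : E.level x = m
    swap
    · rwa [List.filter_cons_of_neg (by simp [hx])]
    rw [List.filter_cons_of_pos (by simp [hx]), List.isChain_cons]
    refine ⟨fun z hz => ?_, ih⟩
    have hzs := List.mem_filter.1 (List.mem_of_mem_head? hz)
    have hlz : E.level z = m := by simpa using hzs.2
    have hxz : x ≠ z := by
      rintro rfl
      exact (List.nodup_cons.1 hd).1 hzs.1
    refine layer_adj_iff.2 ⟨?_, hx.trans hlz.symm⟩
    cases s with
    | nil => simp at hz
    | cons y s =>
      rw [List.isChain_cons_cons] at hs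
      rcases (hm' y (by simp)).eq_or_lt with hy | hy
      · rw [List.filter_cons_of_pos (by simp [hy])] at hz
        simp only [List.head?_cons, Option.mem_def, Option.some.injEq] at hz
        exact hz ▸ hs.1
      · rw [List.filter_cons_of_neg (by simp [hy.ne'])] at hz
        exact hE.adj_of_mem_shadow (hE.mem_shadow hs.1 hx hy)
          (hE.head_filter_mem_shadow hs.2 (fun v hv => hm' v (by simp [hv])) hy hz) hxz

/-- The two halves of a path whose levels are colored repetitively visit the same levels. -/
lemma IsChordal.map_level_eq (hE : E.IsChordal) {a b : List ℕ} (hs : (a ++ b).IsChain E.Adj)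
    (h : a.map (fun v => levelColor (E.level v)) = b.map fun v => levelColor (E.level v)) :
    a.map E.level = b.map E.level := by
  have hl : a.length = b.length := by simpa using congrArg List.length h
  set f : ℕ → ℕ := fun i => E.level ((a ++ b).getD i 0) with hf
  have hfa : ∀ i (hi : i < a.length), f i = E.level a[i] := by
    intro i hi
    simp [hf, List.getD_eq_getElem?_getD, List.getElem?_append_left hi, hi]
  have hfb : ∀ i (hi : i < b.length), f (i + a.length) = E.level b[i] := by
    intro i hi
    simp [hf, List.getD_eq_getElem?_getD, List.getElem?_append_right, hi]
  have key := lazy_walk_halves_eq (f := f) (l := a.length) ?_ ?_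
  · refine List.ext_getElem (by simpa using hl) fun i h1 h2 => ?_
    simp only [List.length_map] at h1 h2
    have := key i h1
    rw [hfa i h1, hfb i h2] at this
    simpa using this
  · intro i hi
    have hi' : i + 1 < (a ++ b).length := by simp only [List.length_append]; omega
    have := hE.level_le_of_adj (List.isChain_iff_getElem.1 hs i hi')
    simp only [hf, List.getD_eq_getElem?_getD, List.getElem?_eq_getElem hi',
      List.getElem?_eq_getElem (Nat.lt_of_succ_lt hi'), Option.getD_some]
    exact this
  · intro i hi
    rw [hfa i hi, hfb i (hl ▸ hi)]
    have := List.getElem_of_eq h (i := i) (by simpa using hi)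
    simpa using this

/-- The coloring of an attachment order by levels and layers is nonrepetitive: if it were repetitive
on a path, the lowest vertices of the path would form a path in a layer, colored repetitively since
both halves of the original path visit the lowest level at corresponding places. -/
theorem IsChordal.color_nonrepetitive {k : ℕ} {E : AttachmentOrder} (hE : E.IsChordal)
    (hk : ∀ v, (E.nbr v).card ≤ k) {s : List ℕ} (hs : s.IsChain E.Adj) (hd : s.Nodup) :
    ¬ IsRepetition (s.map (E.color k)) := by
  rintro ⟨w, hw, hsw⟩
  obtain ⟨a, b, rfl, ha, hb⟩ := List.map_eq_append_iff.1 hsw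
  have hane : a ≠ [] := by rintro rfl; exact hw (by simpa using ha.symm)
  have hbne : b ≠ [] := by rintro rfl; exact hw (by simpa using hb.symm)
  clear hsw
  induction k generalizing E a b with
  | zero =>
    have hn : ∀ u v, ¬ E.Adj u v := by
      have : ∀ v, E.nbr v = ∅ := fun v => by simpa using hk v
      intro u v
      simp [Adj, this]
    match a, b, hane, hbne with
    | x :: a, y :: b, _, _ =>
      have hx := List.isChain_append.1 hs
      obtain ⟨z, hz⟩ : ∃ z, z ∈ (x :: a).getLast? :=
        ⟨_, List.getLast?_eq_some_getLast (List.cons_ne_nil x a)⟩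
      exact hn _ _ (hx.2.2 z hz y (by simp))
  | succ k ih =>
    have hab := ha.trans hb.symm
    have hpair : a.map (fun v => (E.layer.color k v, levelColor (E.level v))) =
        b.map fun v => (E.layer.color k v, levelColor (E.level v)) := by
      apply List.map_injective_iff.2 finProdFinEquiv.injective
      rw [List.map_map, List.map_map]
      exact hab
    have h1 : a.map (E.layer.color k) = b.map (E.layer.color k) := by
      simpa [Function.comp_def] using congrArg (List.map Prod.fst) hpair
    have h2 : a.map (fun v => levelColor (E.level v)) = b.map fun v => levelColor (E.level v) := by
      simpa [Function.comp_def] using congrArg (List.map Prod.snd) hpair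
    have h3 := hE.map_level_eq hs h2
    obtain ⟨v, hv, hmin⟩ : ∃ v ∈ a, ∀ u ∈ a, E.level v ≤ E.level u := by
      obtain ⟨v, hv, h⟩ := a.toFinset.exists_min_image E.level
        (List.toFinset_nonempty_iff a |>.2 hane)
      exact ⟨v, by simpa using hv, by simpa using h⟩
    have hm : ∀ u ∈ a ++ b, E.level v ≤ E.level u := by
      intro u hu
      rcases List.mem_append.1 hu with hu | hu
      · exact hmin u hu
      · have : E.level u ∈ a.map E.level := h3 ▸ List.mem_map_of_mem hu
        obtain ⟨u', hu', he⟩ := List.mem_map.1 this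
        exact he ▸ hmin u' hu'
    have hchain := hE.isChain_filter_level hs hd hm
    have h4 : (a.filter fun u => E.level u = E.level v).map (E.layer.color k) =
        (b.filter fun u => E.level u = E.level v).map (E.layer.color k) := by
      have h5 : a.map (fun u => (E.level u, E.layer.color k u)) =
          b.map fun u => (E.level u, E.layer.color k u) := by
        rw [← List.zip_map', ← List.zip_map', h3, h1]
      simpa [List.filter_map, Function.comp_def] using
        congrArg (fun l => (l.filter fun c => c.1 = E.level v).map Prod.snd) h5
    have hfa : (a.filter fun u => E.level u = E.level v) ≠ [] :=
      List.ne_nil_of_mem (List.mem_filter.2 ⟨hv, by simp⟩)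
    have hfb : (b.filter fun u => E.level u = E.level v) ≠ [] := by
      intro h
      rw [h] at h4
      exact hfa (by simpa using h4)
    exact ih (w := (a.filter fun u => E.level u = E.level v).map (E.layer.color k))
      hE.layer (card_nbr_layer_le hk) (by simpa using hfa) _ _
      (by rwa [← List.filter_append]) (by rw [← List.filter_append]; exact hd.filter _)
      rfl h4.symm hfa hfb

/-! ### Colors are assigned online -/

lemma level_congr {E F : AttachmentOrder} {v : ℕ} (h : ∀ u ≤ v, E.nbr u = F.nbr u) :
    E.level v = F.level v := by
  induction v using Nat.strong_induction_on with
  | _ v ih =>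
  rw [level, level, ← h v le_rfl]
  congr 1
  funext ⟨u, hu⟩
  have hlt := E.lt_of_mem v u hu
  simp only [ih u hlt fun x hx => h x (by omega)]

lemma color_congr {k : ℕ} {E F : AttachmentOrder} {v : ℕ} (h : ∀ u ≤ v, E.nbr u = F.nbr u) :
    E.color k v = F.color k v := by
  induction k generalizing E F with
  | zero => rfl
  | succ k ih =>
    have hl : ∀ u ≤ v, E.level u = F.level u := fun u hu =>
      level_congr fun x hx => h x (by omega)
    rw [color, color, hl v le_rfl, ih]
    intro u hu
    ext x
    rw [mem_nbr_layer, mem_nbr_layer, ← h u hu, ← hl u hu]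
    refine and_congr_right fun hx => ?_
    rw [hl x ((E.lt_of_mem u x hx).le.trans hu)]

open Classical in
/-- The attachment order of a history `G 0, …, G t`: each `v_s` with `s ≤ t` is attached to its
neighbors in `G s`, the graph at its arrival. Edges that are deleted later are kept. -/
noncomputable def ofHistory (t : ℕ) (G : (s : Fin (t + 1)) → SimpleGraph (Fin (s.val + 1))) :
    AttachmentOrder where
  nbr v := if h : v < t + 1 then
      (Finset.univ.filter fun u : Fin (v + 1) => (G ⟨v, h⟩).Adj u (Fin.last v)).map
        Fin.valEmbedding
    else ∅
  lt_of_mem v u hu := by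
    split_ifs at hu
    · obtain ⟨x, hx, rfl⟩ := Finset.mem_map.1 hu
      have := (Finset.mem_filter.1 hx).2.ne
      exact Fin.val_lt_last this
    · simp at hu

lemma mem_nbr_ofHistory {t v u : ℕ} {G : (t : ℕ) → SimpleGraph (Fin (t + 1))} (hv : v ≤ t) :
    u ∈ (ofHistory t fun s => G s).nbr v ↔
      ∃ h : u < v + 1, (G v).Adj ⟨u, h⟩ (Fin.last v) := by
  simp only [ofHistory, dif_pos (Nat.lt_succ_of_le hv), Finset.mem_map, Finset.mem_filter,
    Finset.mem_univ, true_and, Fin.valEmbedding_apply]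
  constructor
  · rintro ⟨x, hx, rfl⟩
    exact ⟨x.2, hx⟩
  · rintro ⟨h, hu⟩
    exact ⟨⟨u, h⟩, hu, rfl⟩

lemma nbr_ofHistory_congr {r t v : ℕ} {G : (t : ℕ) → SimpleGraph (Fin (t + 1))} (hr : v ≤ r)
    (ht : v ≤ t) : (ofHistory r fun s => G s).nbr v = (ofHistory t fun s => G s).nbr v := by
  ext u
  rw [mem_nbr_ofHistory hr, mem_nbr_ofHistory ht]

end AttachmentOrder

/-! ### Online processes -/

lemma onlineStep_adj_castSucc {n : ℕ} {G : SimpleGraph (Fin n)} {D : Finset (Fin n)}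
    {C : Set (Sym2 (Fin n))} {u v : Fin n}
    (h : (onlineStep G D C).Adj u.castSucc v.castSucc) : G.Adj u v := by
  rcases h with h | h
  · rw [SimpleGraph.map_adj] at h
    obtain ⟨x, y, hxy, hx, hy⟩ := h
    obtain rfl : x = u := Fin.castSucc_injective n hx
    obtain rfl : y = v := Fin.castSucc_injective n hy
    exact (SimpleGraph.deleteEdges_le _) hxy
  · rw [SimpleGraph.fromEdgeSet_adj] at h
    obtain ⟨⟨x, -, hx⟩, -⟩ := h
    have : Fin.last n ∈ s(u.castSucc, v.castSucc) := hx ▸ Sym2.mem_mk_right _ _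
    rcases Sym2.mem_iff.1 this with h | h
    · exact absurd h.symm (Fin.castSucc_ne_last u)
    · exact absurd h.symm (Fin.castSucc_ne_last v)

lemma onlineStep_adj_last {n : ℕ} {G : SimpleGraph (Fin n)} {D : Finset (Fin n)}
    {C : Set (Sym2 (Fin n))} {u : Fin n} :
    (onlineStep G D C).Adj u.castSucc (Fin.last n) ↔ u ∈ D := by
  constructor
  · rintro (h | h)
    · rw [SimpleGraph.map_adj] at h
      obtain ⟨x, y, hxy, hx, hy⟩ := h
      exact absurd hy (Fin.castSucc_ne_last y)
    · rw [SimpleGraph.fromEdgeSet_adj] at h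
      obtain ⟨⟨x, hx, he⟩, -⟩ := h
      have : x.castSucc = u.castSucc := by simpa using he
      exact Fin.castSucc_injective n this ▸ hx
  · intro h
    refine Or.inr ((SimpleGraph.fromEdgeSet_adj _).2 ⟨⟨u, h, rfl⟩, Fin.castSucc_ne_last u⟩)

/-- The earlier of two adjacent vertices was already a neighbor of the later one when the latter
arrived. -/
lemma IsOnlineProcess.adj_last {R : OnlineRestriction} {n : ℕ∞}
    {G : (t : ℕ) → SimpleGraph (Fin (t + 1))} (hG : IsOnlineProcess R n G) {t : ℕ}
    (ht : (t : ℕ∞) ≤ n) {u v : ℕ} (huv : u < v) (hv : v < t + 1)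
    (h : (G t).Adj ⟨u, huv.trans hv⟩ ⟨v, hv⟩) :
    (G v).Adj ⟨u, Nat.lt_succ_of_lt huv⟩ (Fin.last v) := by
  induction t with
  | zero => omega
  | succ t ih =>
    rcases Nat.lt_or_ge v (t + 1) with hvt | hvt
    · have htn : (t : ℕ∞) < n := lt_of_lt_of_le (by exact_mod_cast Nat.lt_succ_self t) ht
      obtain ⟨D, C, -, -, hstep⟩ := hG t htn
      rw [hstep] at h
      exact ih htn.le hvt (onlineStep_adj_castSucc (u := ⟨u, huv.trans hvt⟩) (v := ⟨v, hvt⟩) h)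
    · obtain rfl : v = t + 1 := by omega
      exact h

/-- In an online partial `k`-tree, each vertex is attached on its arrival to a clique of at most
`k` vertices; of the restriction, only this is used. -/
lemma AttachmentOrder.isChordal_ofHistory {k : ℕ} {n : ℕ∞}
    {G : (t : ℕ) → SimpleGraph (Fin (t + 1))} (hG : IsOnlineProcess (onlinePartialKTree k) n G)
    {t : ℕ} (ht : (t : ℕ∞) ≤ n) :
    (ofHistory t fun s => G s).IsChordal ∧ ∀ v, ((ofHistory t fun s => G s).nbr v).card ≤ k := by
  have key : ∀ v, ((ofHistory t fun s => G s).nbr v = ∅) ∨ ∃ w, v = w + 1 ∧ w < t ∧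
      ∃ D : Finset (Fin (w + 1)), (G w).IsClique (D : Set (Fin (w + 1))) ∧ D.card ≤ k ∧
        (ofHistory t fun s => G s).nbr v = D.map Fin.valEmbedding := by
    intro v
    rcases Nat.lt_or_ge t v with hv | hv
    · left
      exact dif_neg (by omega)
    cases v with
    | zero =>
      left
      refine Finset.eq_empty_of_forall_notMem fun u hu => ?_
      exact absurd (lt_of_mem _ 0 u hu) (Nat.not_lt_zero u)
    | succ w =>
      right
      have hwn : (w : ℕ∞) < n := lt_of_lt_of_le (by exact_mod_cast hv) ht
      obtain ⟨D, C, -, ⟨-, hD, hk⟩, hstep⟩ := hG w hwn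
      refine ⟨w, rfl, hv, D, hD, hk, ?_⟩
      ext u
      rw [mem_nbr_ofHistory hv, hstep, Finset.mem_map]
      constructor
      · rintro ⟨hu, h⟩
        have hlt : u < w + 1 := Fin.val_lt_last h.ne
        exact ⟨⟨u, hlt⟩, onlineStep_adj_last.1 h, rfl⟩
      · rintro ⟨x, hx, rfl⟩
        exact ⟨Nat.lt_succ_of_lt x.2, onlineStep_adj_last.2 hx⟩
  constructor
  · intro v x hx y hy hxy
    rcases key v with h | ⟨w, rfl, hw, D, hD, -, h⟩
    · simp [h] at hx
    · rw [h] at hx hy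
      obtain ⟨x, hxD, rfl⟩ := Finset.mem_map.1 hx
      obtain ⟨y, hyD, rfl⟩ := Finset.mem_map.1 hy
      have hxy' : x.val < y.val := hxy
      have hy' := y.2
      refine (mem_nbr_ofHistory (show y.val ≤ t by omega)).2 ⟨Nat.lt_succ_of_lt hxy', ?_⟩
      have hwn : (w : ℕ∞) ≤ n := le_trans (by exact_mod_cast hw.le) ht
      exact hG.adj_last hwn hxy' y.2 (hD hxD hyD (Fin.ne_of_lt hxy'))
  · intro v
    rcases key v with h | ⟨w, rfl, hw, D, -, hk, h⟩
    · simp [h]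
    · rwa [h, Finset.card_map]

theorem corollary2 (k : ℕ) :
    OnlineNonrepetitivelyColorable (onlinePartialKTree k) (Fin (4 ^ k)) := by
  refine ⟨fun t G => (AttachmentOrder.ofHistory t G).color k t, fun n G hG t ht u v p hp hrep => ?_⟩
  obtain ⟨hchordal, hk⟩ := AttachmentOrder.isChordal_ofHistory hG ht
  have hadj : ∀ x y : Fin (t + 1), (G t).Adj x y →
      (AttachmentOrder.ofHistory t fun s => G s).Adj x.val y.val := by
    have aux : ∀ x y : Fin (t + 1), x < y → (G t).Adj x y →
        x.val ∈ (AttachmentOrder.ofHistory t fun s => G s).nbr y.val := fun x y hxy h =>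
      (AttachmentOrder.mem_nbr_ofHistory (Nat.le_of_lt_succ y.2)).2
        ⟨_, hG.adj_last ht hxy y.2 h⟩
    intro x y h
    rcases lt_or_gt_of_ne h.ne with hxy | hxy
    · exact Or.inl (aux x y hxy h)
    · exact Or.inr (aux y x hxy h.symm)
  refine hchordal.color_nonrepetitive hk (s := p.support.map Fin.val)
    (List.isChain_map_of_isChain _ hadj p.isChain_adj_support)
    (hp.support_nodup.map Fin.val_injective) ?_
  rw [List.map_map]
  -- The color given to a vertex on its arrival agrees with the one computed at time `t`.
  convert hrep using 2
  funext i
  exact AttachmentOrder.color_congr fun x hx =>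
    AttachmentOrder.nbr_ofHistory_congr (by have := i.2; omega) hx
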